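/- **Theorem C.** Let $R=\bigoplus_{i=1}^n\mathbb{F}_i$ be a finite direct sum of fields and let $G=Q_8\times A$, where $Q_8$ is the quaternion group of order 8 and $A$ is a finite abelian group. Suppose that for every $i$ the characteristic of $\mathbb{F}_i$ does not divide $|G|$. Let $s$ be the nontrivial element of the commutator subgroup $G'=\{1,s\}$, and let $*$ be the involution of the group ring $RG$ obtained by extending $R$-linearly the canonical involution of $G$, given by $g^*=g$ if $g$ lies in the center $\mathcal{Z}(G)$ and $g^*=sg$ otherwise. Then $RG$ is $*$-clean (that is, each of its elements is the sum of a unit and an idempotent $p$ with $p^*=p$) if and only if, for every $i$ and every $d\in\mathbb{N}$ such that $A$ has an element of order $d$, the equation $X^2+Y^2+Z^2+1=0$ has no solution in $\mathbb{F}_i(\zeta_d)$, where $\zeta_d$ is a primitive $d$-th root of $1$. -/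

import Mathlib

/-- A group `G` is an SLC-group if its commutator subgroup has the form `{1, s}` with `s ≠ 1`,
and `G` has the lack of commutativity property: if `x` and `y` commute, then `x`, `y` or `x * y`
is central. -/
class IsSLCGroup (G : Type*) [Group G] : Prop where
  exists_commutator_eq : ∃ s : G, s ≠ 1 ∧ (commutator G : Set G) = {1, s}
  lack_of_commutativity : ∀ x y : G, x * y = y * x →
    x ∈ Subgroup.center G ∨ y ∈ Subgroup.center G ∨ x * y ∈ Subgroup.center G

namespace IsSLCGroup

/-- The unique nontrivial commutator of an SLC-group. -/
noncomputable def s (G : Type*) [Group G] [IsSLCGroup G] : G :=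
  (exists_commutator_eq (G := G)).choose

open Classical in
/-- The canonical involution of an SLC-group: `x ↦ x` for central `x`, and `x ↦ s * x` for
noncentral `x`. -/
noncomputable def canonicalInvolution (G : Type*) [Group G] [IsSLCGroup G] (x : G) : G :=
  if x ∈ Subgroup.center G then x else s G * x

section

variable {G : Type*} [Group G] [IsSLCGroup G]

theorem s_ne_one : s G ≠ 1 := (exists_commutator_eq (G := G)).choose_spec.1

theorem commutator_eq : (commutator G : Set G) = {1, s G} :=
  (exists_commutator_eq (G := G)).choose_spec.2

theorem mem_commutator_iff (x : G) : x ∈ commutator G ↔ x = 1 ∨ x = s G := by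
  rw [← SetLike.mem_coe, commutator_eq]
  simp

theorem s_mul_s : s G * s G = 1 := by
  have hs : s G ∈ commutator G := (mem_commutator_iff _).2 (Or.inr rfl)
  rcases (mem_commutator_iff _).1 (mul_mem hs hs) with h | h
  · exact h
  · exact absurd (mul_eq_left.1 h) s_ne_one

theorem s_mem_center : s G ∈ Subgroup.center G := by
  have hs : s G ∈ commutator G := (mem_commutator_iff _).2 (Or.inr rfl)
  refine Subgroup.mem_center_iff.2 fun g => ?_
  have hn : (commutator G).Normal := inferInstance
  rcases (mem_commutator_iff _).1 (hn.conj_mem _ hs g) with h | h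
  · exact absurd (by simpa using h) (s_ne_one (G := G))
  · exact mul_inv_eq_iff_eq_mul.1 h

theorem s_mul_mem_center_iff (x : G) :
    s G * x ∈ Subgroup.center G ↔ x ∈ Subgroup.center G :=
  Subgroup.mul_mem_cancel_left _ s_mem_center

theorem canonicalInvolution_of_mem {x : G} (hx : x ∈ Subgroup.center G) :
    canonicalInvolution G x = x := if_pos hx

theorem canonicalInvolution_of_notMem {x : G} (hx : x ∉ Subgroup.center G) :
    canonicalInvolution G x = s G * x := if_neg hx

theorem canonicalInvolution_one : canonicalInvolution G 1 = 1 :=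
  canonicalInvolution_of_mem (one_mem _)

theorem canonicalInvolution_canonicalInvolution (x : G) :
    canonicalInvolution G (canonicalInvolution G x) = x := by
  by_cases hx : x ∈ Subgroup.center G
  · rw [canonicalInvolution_of_mem hx, canonicalInvolution_of_mem hx]
  · have hsx : s G * x ∉ Subgroup.center G := by rwa [s_mul_mem_center_iff]
    rw [canonicalInvolution_of_notMem hx, canonicalInvolution_of_notMem hsx, ← mul_assoc,
      s_mul_s, one_mul]

theorem canonicalInvolution_mul (x y : G) :
    canonicalInvolution G (x * y) = canonicalInvolution G y * canonicalInvolution G x := by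
  have hsc : ∀ g : G, g * s G = s G * g := Subgroup.mem_center_iff.1 s_mem_center
  by_cases hx : x ∈ Subgroup.center G
  · have hxc : ∀ g : G, g * x = x * g := Subgroup.mem_center_iff.1 hx
    by_cases hy : y ∈ Subgroup.center G
    · rw [canonicalInvolution_of_mem hx, canonicalInvolution_of_mem hy,
        canonicalInvolution_of_mem (mul_mem hx hy), hxc]
    · have hxy : x * y ∉ Subgroup.center G := by rwa [Subgroup.mul_mem_cancel_left _ hx]
      rw [canonicalInvolution_of_mem hx, canonicalInvolution_of_notMem hy,
        canonicalInvolution_of_notMem hxy, mul_assoc, hxc]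
  · by_cases hy : y ∈ Subgroup.center G
    · have hyc : ∀ g : G, g * y = y * g := Subgroup.mem_center_iff.1 hy
      have hxy : x * y ∉ Subgroup.center G := by rwa [Subgroup.mul_mem_cancel_right _ hy]
      rw [canonicalInvolution_of_notMem hx, canonicalInvolution_of_mem hy,
        canonicalInvolution_of_notMem hxy, ← hyc, mul_assoc]
    · rw [canonicalInvolution_of_notMem hx, canonicalInvolution_of_notMem hy]
      have hr : s G * y * (s G * x) = y * x := by
        rw [mul_assoc, ← mul_assoc y, hsc, mul_assoc (s G), ← mul_assoc, s_mul_s, one_mul]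
      rw [hr]
      by_cases hxy : x * y ∈ Subgroup.center G
      · rw [canonicalInvolution_of_mem hxy]
        have h := Subgroup.mem_center_iff.1 hxy x
        rw [mul_assoc] at h
        exact mul_left_cancel h
      · rw [canonicalInvolution_of_notMem hxy]
        have hne : y * x ≠ x * y := fun h => by
          rcases lack_of_commutativity x y h.symm with h | h | h
          · exact hx h
          · exact hy h
          · exact hxy h
        have hmem : y * x * y⁻¹ * x⁻¹ ∈ commutator G :=
          Subgroup.commutator_mem_commutator (Subgroup.mem_top y) (Subgroup.mem_top x)
        rcases (mem_commutator_iff _).1 hmem with h | h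
        · refine absurd ?_ hne
          rw [mul_inv_eq_one, mul_inv_eq_iff_eq_mul] at h
          exact h
        · rw [← h]
          group

end

/-- The `R`-linear extension of the canonical involution of an SLC-group `G` to the group ring
`RG`, as a ring involution. -/
noncomputable def groupRingInvolution (R G : Type*) [CommRing R] [Group G] [IsSLCGroup G] :
    RingInvo (MonoidAlgebra R G) :=
  RingInvo.mk'
    { toFun := fun x => MulOpposite.op (MonoidAlgebra.mapDomain (canonicalInvolution G) x)
      map_one' := by
        rw [MonoidAlgebra.one_def, MonoidAlgebra.mapDomain_single, canonicalInvolution_one]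
        rfl
      map_zero' := by simp
      map_add' := fun x y => by rw [MonoidAlgebra.mapDomain_add, MulOpposite.op_add]
      map_mul' := fun x y => by
        rw [← MulOpposite.op_mul]
        congr 1
        induction x using MonoidAlgebra.induction_linear with
        | zero => simp
        | add x₁ x₂ h₁ h₂ =>
          rw [add_mul, MonoidAlgebra.mapDomain_add, MonoidAlgebra.mapDomain_add, h₁, h₂, mul_add]
        | single g r =>
          induction y using MonoidAlgebra.induction_linear with
          | zero => simp
          | add y₁ y₂ h₁ h₂ =>
            rw [mul_add, MonoidAlgebra.mapDomain_add, MonoidAlgebra.mapDomain_add, h₁, h₂,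
              add_mul]
          | single h t =>
            simp only [MonoidAlgebra.single_mul_single, MonoidAlgebra.mapDomain_single,
              canonicalInvolution_mul, mul_comm r t] }
    (fun x => by
      change MonoidAlgebra.mapDomain (canonicalInvolution G)
        (MonoidAlgebra.mapDomain (canonicalInvolution G) x) = x
      induction x using MonoidAlgebra.induction_linear with
      | zero => simp
      | add x₁ x₂ h₁ h₂ =>
        rw [MonoidAlgebra.mapDomain_add, MonoidAlgebra.mapDomain_add, h₁, h₂]
      | single g r =>
        simp only [MonoidAlgebra.mapDomain_single, canonicalInvolution_canonicalInvolution])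

/-- `Q₈ × A` is an SLC-group for every abelian group `A`. -/
instance quaternionProd (A : Type*) [CommGroup A] : IsSLCGroup (QuaternionGroup 2 × A) where
  exists_commutator_eq := by
    have hQ : ∀ x y : QuaternionGroup 2,
        x * y * x⁻¹ * y⁻¹ = 1 ∨ x * y * x⁻¹ * y⁻¹ = QuaternionGroup.a 2 := by decide
    refine ⟨(QuaternionGroup.a 2, 1), ?_, ?_⟩
    · intro h
      have h1 : (QuaternionGroup.a 2 : QuaternionGroup 2) = 1 := congrArg Prod.fst h
      exact absurd h1 (by decide)
    · let H : Subgroup (QuaternionGroup 2 × A) :=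
        { carrier := {1, (QuaternionGroup.a 2, 1)}
          one_mem' := Or.inl rfl
          mul_mem' := by
            rintro x y (rfl | rfl) (rfl | rfl)
            · left; simp
            · right; simp
            · right; simp
            · left
              have h1 : (QuaternionGroup.a 2 * QuaternionGroup.a 2 : QuaternionGroup 2) = 1 := by
                decide
              exact Prod.ext h1 (one_mul 1)
          inv_mem' := by
            rintro x (rfl | rfl)
            · left; simp
            · right
              have h1 : (QuaternionGroup.a 2 : QuaternionGroup 2)⁻¹ = QuaternionGroup.a 2 := by
                decide
              exact Prod.ext h1 inv_one }
      have hle : commutator (QuaternionGroup 2 × A) ≤ H := by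
        rw [commutator_def, Subgroup.commutator_le]
        rintro ⟨x, a⟩ - ⟨y, b⟩ -
        have hab : a * b * a⁻¹ * b⁻¹ = 1 := by rw [mul_comm a b]; group
        rcases hQ x y with h | h
        · exact Or.inl (Prod.ext h hab)
        · exact Or.inr (Prod.ext h hab)
      refine Set.Subset.antisymm hle ?_
      rintro x (rfl | rfl)
      · exact one_mem _
      · have h : ((QuaternionGroup.a 1, 1) : QuaternionGroup 2 × A) * (QuaternionGroup.xa 0, 1) *
            (QuaternionGroup.a 1, 1)⁻¹ * (QuaternionGroup.xa 0, 1)⁻¹ ∈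
              commutator (QuaternionGroup 2 × A) :=
          Subgroup.commutator_mem_commutator (Subgroup.mem_top _) (Subgroup.mem_top _)
        have h1 : (QuaternionGroup.a 1 * QuaternionGroup.xa 0 * (QuaternionGroup.a 1)⁻¹ *
            (QuaternionGroup.xa 0)⁻¹ : QuaternionGroup 2) = QuaternionGroup.a 2 := by decide
        have h2 : (1 * 1 * 1⁻¹ * 1⁻¹ : A) = 1 := by simp
        have h' : ((QuaternionGroup.a 1, 1) : QuaternionGroup 2 × A) * (QuaternionGroup.xa 0, 1) *
            (QuaternionGroup.a 1, 1)⁻¹ * (QuaternionGroup.xa 0, 1)⁻¹ =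
              (QuaternionGroup.a 2, 1) := Prod.ext h1 h2
        rwa [h'] at h
  lack_of_commutativity := by
    have hQ : ∀ x y : QuaternionGroup 2, x * y = y * x →
        (∀ g, g * x = x * g) ∨ (∀ g, g * y = y * g) ∨ ∀ g, g * (x * y) = x * y * g := by
      decide
    have hc : ∀ x : QuaternionGroup 2 × A, (∀ g, g * x.1 = x.1 * g) →
        x ∈ Subgroup.center (QuaternionGroup 2 × A) := fun x h =>
      Subgroup.mem_center_iff.2 fun g => Prod.ext (h g.1) (mul_comm _ _)
    intro x y hxy
    rcases hQ x.1 y.1 (congrArg Prod.fst hxy) with h | h | h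
    · exact Or.inl (hc x h)
    · exact Or.inr (Or.inl (hc y h))
    · exact Or.inr (Or.inr (hc (x * y) h))

end IsSLCGroup

/-- A ring `S` with involution `σ` is `*`-clean if each of its elements is the sum of a unit and
a projection, that is, an idempotent fixed by `σ`. -/
def IsStarClean {S : Type*} [Ring S] (σ : RingInvo S) : Prop :=
  ∀ r : S, ∃ u p : S, IsUnit u ∧ IsIdempotentElem p ∧ (σ p).unop = p ∧ r = u + p

/-!
On `Q₈ × A` the canonical involution is `(q, a) ↦ (q⁻¹, a)`, so for a field `L` and a character
`χ : A → L` the group ring maps, compatibly with the involutions, onto the four one-dimensional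
representations of `Q₈` over `L` (trivial involution) and to the Hamilton quaternions over `L`
(quaternion conjugation). The quaternions over `L` have isotropic norm form exactly when `-1` is a
sum of three squares in `L`.

If no field `Fᵢ(ζ_d)` contains a solution, the involution is proper: `x x* = 0` implies `x = 0`.
Indeed `Fᵢ[A]` is semisimple, so its elements are detected by its quotient fields; each of these is
generated over `Fᵢ` by the values of a character, hence is `Fᵢ(ζ_d)` for the order `d` of some
element of `A` (`exists_orderOf_eq_and_isCyclotomicExtension`), and over such a field the five
representations of `Q₈` are proper and separate points
(`sum_coeff_eq_zero_of_mul_involution_eq_zero`). Moreover `x + x*` is always central, so `x`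
commutes with `x*`. Since the group ring is finite over an Artinian ring, `c = x x*` is von Neumann
regular, `c = c² t` with `t` a polynomial in `c`; then `p = 1 - c t` is a projection which
annihilates `x`, and `x - p` is a unit with inverse `x* t - p` (`isStarClean_of_proper`).

Conversely, let `X² + Y² + Z² + 1 = 0` in `Fᵢ(ζ_d)` with `d` the order of an element of `A`. As `A`
is isomorphic to its group of characters over an algebraically closed field, some character of `A`
has order `d`, and the image of the group ring in the quaternions contains those with coordinates in
`Fᵢ(ζ_d)`, in particular `e = (1 + X i + Y j + Z k) / 2`. Neither `e` nor `e - 1` is a unit, their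
norms being zero, while every projection maps to `0` or `1`
(`not_isStarClean_of_sum_sq`).
-/

open MonoidAlgebra
open scoped Quaternion

/-! ### Proper involutions on finite algebras over Artinian rings -/

section ProperInvolution

variable {R S : Type*} [CommRing R] [Ring S] [Algebra R S]

theorem RingInvo.unop_map_mul (σ : RingInvo S) (x y : S) :
    (σ (x * y)).unop = (σ y).unop * (σ x).unop := by
  rw [map_mul, MulOpposite.unop_mul]

theorem RingInvo.unop_eq_of_mem_adjoin_singleton (σ : RingInvo S)
    (hσ : ∀ r : R, (σ (algebraMap R S r)).unop = algebraMap R S r) {c t : S}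
    (hc : (σ c).unop = c) (ht : t ∈ Algebra.adjoin R {c}) : (σ t).unop = t := by
  have hcomm : ∀ x ∈ Algebra.adjoin R {c}, ∀ y ∈ Algebra.adjoin R {c}, x * y = y * x :=
    fun x hx y hy => congrArg Subtype.val
      (mul_comm (⟨x, hx⟩ : Algebra.adjoin R {c}) ⟨y, hy⟩)
  induction ht using Algebra.adjoin_induction with
  | mem x hx => rw [Set.mem_singleton_iff.1 hx, hc]
  | algebraMap r => exact hσ r
  | add x y _ _ hx hy => rw [map_add, MulOpposite.unop_add, hx, hy]
  | mul x y hx' hy' hx hy => rw [σ.unop_map_mul, hx, hy, hcomm y hy' x hx']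

theorem exists_eq_sq_mul_of_isArtinianRing (C : Type*) [CommRing C] [IsArtinianRing C]
    [IsReduced C] (c : C) : ∃ t, c = c * c * t := by
  obtain ⟨n, t, ht⟩ := IsArtinian.exists_pow_succ_smul_dvd c (1 : C)
  refine ⟨t, sub_eq_zero.1 (IsReduced.eq_zero _ ⟨n + 1, ?_⟩)⟩
  have h : c ^ n * (1 - c * t) = 0 := by
    simp only [smul_eq_mul, mul_one] at ht
    rw [← sub_eq_zero.2 ht.symm, Nat.succ_eq_add_one]; ring
  calc (c - c * c * t) ^ (n + 1) = c ^ n * (1 - c * t) * (c * (1 - c * t) ^ n) := by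
        rw [show c - c * c * t = c * (1 - c * t) by ring, mul_pow]; ring
    _ = 0 := by rw [h, zero_mul]

/-- An element of a module-finite algebra over an Artinian ring, no nonzero polynomial
expression in which is nilpotent, is von Neumann regular. -/
theorem exists_mem_adjoin_singleton_eq_sq_mul [IsArtinianRing R] [Module.Finite R S] (c : S)
    (hred : ∀ t ∈ Algebra.adjoin R {c}, t * t = 0 → t = 0) :
    ∃ t ∈ Algebra.adjoin R {c}, c = c * c * t := by
  let C := Algebra.adjoin R {c}
  have : IsArtinian R C := isArtinian_submodule' C.toSubmodule
  have : IsArtinianRing C := isArtinian_of_tower R this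
  have : IsReduced C := isReduced_iff_pow_one_lt 2 one_lt_two |>.2 fun x hx => by
    apply Subtype.ext
    exact hred x x.2 (by simpa [sq] using congrArg Subtype.val hx)
  obtain ⟨t, ht⟩ :=
    exists_eq_sq_mul_of_isArtinianRing C ⟨c, Algebra.self_mem_adjoin_singleton R c⟩
  exact ⟨t, t.2, congrArg Subtype.val ht⟩

/-- A normal element `r` is annihilated by the projection `p` onto the kernel of `r * r^*`,
and `r - p` is invertible. -/
theorem isStarClean_of_proper [IsArtinianRing R] [Module.Finite R S] (σ : RingInvo S)
    (hσ : ∀ r : R, (σ (algebraMap R S r)).unop = algebraMap R S r)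
    (hnormal : ∀ x : S, Commute x (σ x).unop)
    (hproper : ∀ x : S, x * (σ x).unop = 0 → x = 0) : IsStarClean σ := by
  intro r
  obtain ⟨q, hq⟩ : ∃ q, (σ r).unop = q := ⟨_, rfl⟩
  have hqr : (σ q).unop = r := by rw [← hq]; exact σ.involution' r
  have hrq : r * q = q * r := by rw [← hq]; exact hnormal r
  obtain ⟨c, hc⟩ : ∃ c, c = r * q := ⟨_, rfl⟩
  have hcσ : (σ c).unop = c := by rw [hc, σ.unop_map_mul, hq, hqr]
  have hfix : ∀ t ∈ Algebra.adjoin R {c}, (σ t).unop = t :=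
    fun t ht => σ.unop_eq_of_mem_adjoin_singleton hσ hcσ ht
  obtain ⟨t, ht, hct⟩ := exists_mem_adjoin_singleton_eq_sq_mul (R := R) c fun t ht h =>
    hproper t (by rwa [hfix t ht])
  have hrc : Commute r c := by rw [hc]; exact (Commute.refl r).mul_right hrq
  have hqc : Commute q c := by rw [hc]; exact Commute.mul_right hrq.symm (Commute.refl q)
  have hcomm : ∀ x, Commute x c → Commute x t := fun x hx =>
    Algebra.commute_of_mem_adjoin_singleton_of_commute ht hx
  have hrt := hcomm r hrc
  have hqt := hcomm q hqc
  have htc := hcomm c (Commute.refl c)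
  obtain ⟨p, hp⟩ : ∃ p, p = 1 - c * t := ⟨_, rfl⟩
  have hrp : Commute r p := by
    rw [hp]; exact (Commute.one_right r).sub_right (hrc.mul_right hrt)
  have hqp : Commute q p := by
    rw [hp]; exact (Commute.one_right q).sub_right (hqc.mul_right hqt)
  have htp : Commute t p := by
    rw [hp]; exact (Commute.one_right t).sub_right (htc.symm.mul_right (Commute.refl t))
  have hcp : c * p = 0 := by rw [hp, mul_sub, mul_one, ← mul_assoc, ← hct, sub_self]
  have hpp : p * p = p := by
    nth_rw 1 [hp]
    rw [sub_mul, one_mul, mul_assoc, htp.eq, ← mul_assoc, hcp, zero_mul, sub_zero]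
  have hpσ : (σ p).unop = p := hfix p (by
    rw [hp]
    exact sub_mem (one_mem _) (mul_mem (Algebra.self_mem_adjoin_singleton R c) ht))
  have hrp0 : r * p = 0 := hproper _ (by
    rw [σ.unop_map_mul, hpσ, hq, mul_assoc, ← mul_assoc p, hpp, ← hqp.eq, ← mul_assoc, ← hc,
      hcp])
  have hpq0 : p * q = 0 := by
    have h := congrArg (fun x => (σ x).unop) hrp0
    simpa [σ.unop_map_mul, hpσ, hq] using h
  have hct1 : c * t = 1 - p := by rw [hp]; abel
  refine ⟨r - p, p, ?_, hpp, hpσ, by abel⟩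
  have h1 : (r - p) * (q * t - p) = 1 := by
    calc (r - p) * (q * t - p) = r * q * t - r * p - p * q * t + p * p := by noncomm_ring
      _ = 1 := by rw [hrp0, hpq0, hpp, ← hc, hct1]; simp
  have h2 : (q * t - p) * (r - p) = 1 := by
    have : Commute (r - p) (q * t - p) :=
      Commute.sub_right (Commute.mul_right (Commute.sub_left hrq hqp.symm)
        (Commute.sub_left hrt htp.symm)) (Commute.sub_left hrp (Commute.refl p))
    rw [← this.eq, h1]
  exact ⟨⟨_, _, h1, h2⟩, rfl⟩

end ProperInvolution

/-! ### The canonical involution of `Q₈ × A` -/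

namespace IsSLCGroup

section

variable {R G : Type*} [CommRing R] [Group G] [IsSLCGroup G]

theorem groupRingInvolution_single (g : G) (r : R) :
    (groupRingInvolution R G (single g r)).unop = single (canonicalInvolution G g) r :=
  MonoidAlgebra.mapDomain_single

theorem mul_eq_or_eq_s_mul (g h : G) : g * h = h * g ∨ g * h = s G * (h * g) := by
  have hmem : g * h * g⁻¹ * h⁻¹ ∈ commutator G :=
    Subgroup.commutator_mem_commutator (Subgroup.mem_top g) (Subgroup.mem_top h)
  refine ((mem_commutator_iff _).1 hmem).imp (fun h => ?_) fun h => ?_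
  · rwa [mul_inv_eq_one, mul_inv_eq_iff_eq_mul] at h
  · rwa [mul_inv_eq_iff_eq_mul, mul_inv_eq_iff_eq_mul, mul_assoc] at h

/-- The trace of a group element is twice a central element or the sum of a conjugacy class. -/
theorem commute_single_add_single (g h : G) (r t : R) :
    Commute (single g r + single (canonicalInvolution G g) r) (single h t) := by
  have hs : ∀ g : G, g * s G = s G * g := Subgroup.mem_center_iff.1 s_mem_center
  by_cases hg : g ∈ Subgroup.center G
  · rw [canonicalInvolution_of_mem hg]
    have : Commute (single g r) (single h t) := by
      rw [commute_iff_eq, single_mul_single, single_mul_single, mul_comm r,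
        Subgroup.mem_center_iff.1 hg]
    exact this.add_left this
  · rw [canonicalInvolution_of_notMem hg, commute_iff_eq, add_mul, mul_add]
    simp only [single_mul_single, mul_comm r]
    rw [← mul_assoc h, hs, mul_assoc, mul_assoc]
    rcases mul_eq_or_eq_s_mul g h with h' | h'
    · rw [h']
    · rw [h', ← mul_assoc (s G) (s G), s_mul_s, one_mul, add_comm]

theorem commute_add_groupRingInvolution (x y : MonoidAlgebra R G) :
    Commute (x + (groupRingInvolution R G x).unop) y := by
  induction x using MonoidAlgebra.induction_linear with
  | zero => simp
  | add x₁ x₂ h₁ h₂ =>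
    rw [map_add, MulOpposite.unop_add, add_add_add_comm]
    exact h₁.add_left h₂
  | single g r =>
    rw [groupRingInvolution_single]
    induction y using MonoidAlgebra.induction_linear with
    | zero => simp
    | add y₁ y₂ h₁ h₂ => exact h₁.add_right h₂
    | single h t => exact commute_single_add_single g h r t

theorem commute_groupRingInvolution (x : MonoidAlgebra R G) :
    Commute x (groupRingInvolution R G x).unop := by
  have h := (commute_add_groupRingInvolution x x).sub_left (Commute.refl x)
  rw [add_sub_cancel_left] at h
  exact h.symm

theorem groupRingInvolution_algebraMap (r : R) :
    (groupRingInvolution R G (algebraMap R _ r)).unop = algebraMap R _ r := by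
  rw [coe_algebraMap, Function.comp_apply, groupRingInvolution_single, canonicalInvolution_one]

end

variable {A : Type*} [CommGroup A]

theorem s_quaternionProd : s (QuaternionGroup 2 × A) = (QuaternionGroup.a 2, 1) := by
  have hne : (QuaternionGroup.a 1 * QuaternionGroup.xa 0 : QuaternionGroup 2) ≠
      QuaternionGroup.xa 0 * QuaternionGroup.a 1 := by decide
  have ha : (QuaternionGroup.a 1 * QuaternionGroup.xa 0 *
      (QuaternionGroup.xa 0 * QuaternionGroup.a 1)⁻¹ : QuaternionGroup 2) =
      QuaternionGroup.a 2 := by decide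
  rcases mul_eq_or_eq_s_mul ((QuaternionGroup.a 1, 1) : QuaternionGroup 2 × A)
    (QuaternionGroup.xa 0, 1) with h | h
  · exact absurd (congrArg Prod.fst h) hne
  · rw [← mul_inv_eq_iff_eq_mul] at h
    rw [← h]
    exact Prod.ext ha (by simp)

theorem canonicalInvolution_quaternionProd (q : QuaternionGroup 2) (a : A) :
    canonicalInvolution (QuaternionGroup 2 × A) (q, a) = (q⁻¹, a) := by
  have hinv : ∀ q : QuaternionGroup 2, (∀ g, g * q = q * g) → q = q⁻¹ := by decide
  have hs : ∀ q : QuaternionGroup 2, (¬ ∀ g, g * q = q * g) → QuaternionGroup.a 2 * q = q⁻¹ := by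
    decide
  by_cases h : (q, a) ∈ Subgroup.center (QuaternionGroup 2 × A)
  · rw [canonicalInvolution_of_mem h]
    exact Prod.ext (hinv q fun g =>
      congrArg Prod.fst (Subgroup.mem_center_iff.1 h (g, 1))) rfl
  · rw [canonicalInvolution_of_notMem h, s_quaternionProd]
    refine Prod.ext (hs q fun hq => h (Subgroup.mem_center_iff.2 fun g => ?_)) (one_mul a)
    exact Prod.ext (hq g.1) (mul_comm _ _)

end IsSLCGroup

/-! ### Coordinates in the Hamilton quaternions -/

namespace Quaternion

variable {L : Type*} [CommRing L] (w x y z : L)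

/-- The quaternion `w + x i + y j + z k`. -/
def ofCoords : Quaternion L := ⟨w, x, y, z⟩

@[simp] theorem re_ofCoords : (ofCoords w x y z).re = w := rfl

@[simp] theorem imI_ofCoords : (ofCoords w x y z).imI = x := rfl

@[simp] theorem imJ_ofCoords : (ofCoords w x y z).imJ = y := rfl

@[simp] theorem imK_ofCoords : (ofCoords w x y z).imK = z := rfl

end Quaternion

/-! ### Representations of `Q₈` -/

namespace QuaternionGroup

theorem sum_two {M : Type*} [AddCommMonoid M] (f : QuaternionGroup 2 → M) :
    ∑ q, f q = f (a 0) + f (a 1) + f (a 2) + f (a 3) +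
      (f (xa 0) + f (xa 1) + f (xa 2) + f (xa 3)) := by
  have h : (Finset.univ : Finset (QuaternionGroup 2)) =
    {a 0, a 1, a 2, a 3, xa 0, xa 1, xa 2, xa 3} := by decide
  rw [h]
  iterate 7 rw [Finset.sum_insert (by decide)]
  rw [Finset.sum_singleton]
  abel

section lift

variable {T : Type*} [Monoid T] (x y : T) (hx : x ^ 4 = 1) (hy : y * y = x ^ 2)
  (hxy : x * y = y * x ^ 3)

/-- The homomorphism from `Q₈` with `a 1 ↦ x` and `xa 0 ↦ y`, where `x` and `y` satisfy the defining
relations of `Q₈`. The relation `x * y = y * x⁻¹` is written with `x ^ 3` so that the target may be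
any monoid. -/
def liftTwo : QuaternionGroup 2 →* T where
  toFun
    | a i => x ^ i.val
    | xa i => y * x ^ i.val
  map_one' := pow_zero x
  map_mul' := by
    have hmod : ∀ m n : ℕ, (m : ZMod (2 * 2)) = n → x ^ m = x ^ n := fun m n h => by
      rw [pow_eq_pow_mod m hx, pow_eq_pow_mod n hx]
      exact congrArg (x ^ ·) ((ZMod.natCast_eq_natCast_iff _ _ _).1 h)
    have hpow : ∀ m : ℕ, x ^ m * y = y * x ^ (3 * m) := fun m => by
      induction m with
      | zero => simp
      | succ m ih => rw [pow_succ, mul_assoc, hxy, ← mul_assoc, ih, mul_assoc, ← pow_add, mul_add,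
          mul_one]
    have hneg : ∀ i : ZMod (2 * 2), 3 * i = -i := by decide
    have htwo : ∀ i j : ZMod (2 * 2), 2 + (3 * i + j) = 2 + j - i := by decide
    rintro (i | i) (j | j)
    · change x ^ (i + j).val = x ^ i.val * x ^ j.val
      rw [← pow_add]
      exact hmod _ _ (by simp)
    · change y * x ^ (j - i).val = x ^ i.val * (y * x ^ j.val)
      rw [← mul_assoc, hpow, mul_assoc, ← pow_add]
      exact congrArg (y * ·) (hmod _ _ (by
        push_cast
        rw [ZMod.natCast_zmod_val, ZMod.natCast_zmod_val, ZMod.natCast_zmod_val, hneg]; ring))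
    · change y * x ^ (i + j).val = y * x ^ i.val * x ^ j.val
      rw [mul_assoc, ← pow_add]
      exact congrArg (y * ·) (hmod _ _ (by simp))
    · change x ^ ((2 : ℕ) + j - i : ZMod (2 * 2)).val = y * x ^ i.val * (y * x ^ j.val)
      rw [mul_assoc, ← mul_assoc _ y, hpow, mul_assoc, ← mul_assoc y, hy, ← pow_add, ← pow_add]
      exact hmod _ _ (by
        push_cast
        rw [ZMod.natCast_zmod_val, ZMod.natCast_zmod_val, ZMod.natCast_zmod_val, htwo])

theorem liftTwo_a (i : ZMod (2 * 2)) : liftTwo x y hx hy hxy (a i) = x ^ i.val := rfl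

theorem liftTwo_xa (i : ZMod (2 * 2)) : liftTwo x y hx hy hxy (xa i) = y * x ^ i.val := rfl

end lift

variable (L : Type*) [CommRing L]

/-- The linear character of `Q₈` with `a 1 ↦ u` and `xa 0 ↦ v`. -/
def signCharacter (u v : ℤˣ) : QuaternionGroup 2 →* L :=
  ((Int.castRingHom L : ℤ →* L).comp (Units.coeHom ℤ)).comp
    (liftTwo u v (by revert u; decide) (by revert u v; decide) (by revert u v; decide))

theorem signCharacter_inv (u v : ℤˣ) (q : QuaternionGroup 2) :
    signCharacter L u v q⁻¹ = signCharacter L u v q := by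
  simp only [signCharacter, MonoidHom.comp_apply, map_inv, Int.units_inv_eq_self]

/-- The homomorphism from `Q₈` to the Hamilton quaternions over `L` with `a 1 ↦ i` and `xa 0 ↦ j`. -/
def toQuaternion : QuaternionGroup 2 →* Quaternion L :=
  liftTwo (.ofCoords 0 1 0 0) (.ofCoords 0 0 1 0)
    (by apply Quaternion.ext <;> simp [pow_succ]) (by apply Quaternion.ext <;> simp [pow_succ])
    (by apply Quaternion.ext <;> simp [pow_succ])

theorem toQuaternion_a_one : toQuaternion L (a 1) = .ofCoords 0 1 0 0 := pow_one _

theorem toQuaternion_xa_zero : toQuaternion L (xa 0) = .ofCoords 0 0 1 0 := by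
  change Quaternion.ofCoords (0 : L) 0 1 0 * Quaternion.ofCoords (0 : L) 1 0 0 ^ 0 = _
  rw [pow_zero, mul_one]

theorem toQuaternion_xa_three : toQuaternion L (xa 3) = .ofCoords 0 0 0 1 := by
  change Quaternion.ofCoords (0 : L) 0 1 0 * Quaternion.ofCoords (0 : L) 1 0 0 ^ 3 = _
  apply Quaternion.ext <;> simp [pow_succ]

theorem toQuaternion_mul_star (q : QuaternionGroup 2) :
    toQuaternion L q * star (toQuaternion L q) = 1 := by
  have hi : Quaternion.ofCoords (0 : L) 1 0 0 ∈ unitary (Quaternion L) := by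
    constructor <;> apply Quaternion.ext <;> simp
  have hj : Quaternion.ofCoords (0 : L) 0 1 0 ∈ unitary (Quaternion L) := by
    constructor <;> apply Quaternion.ext <;> simp
  rcases q with i | i
  · exact (pow_mem hi i.val).2
  · exact (mul_mem hj (pow_mem hi i.val)).2

theorem toQuaternion_inv (q : QuaternionGroup 2) :
    toQuaternion L q⁻¹ = star (toQuaternion L q) := by
  have h : toQuaternion L q⁻¹ * toQuaternion L q = 1 := by
    rw [← map_mul, inv_mul_cancel, map_one]
  exact left_inv_eq_right_inv h (toQuaternion_mul_star L q)

theorem sum_smul_toQuaternion (c : QuaternionGroup 2 → L) :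
    ∑ q, c q • toQuaternion L q =
      .ofCoords (c (a 0) - c (a 2)) (c (a 1) - c (a 3)) (c (xa 0) - c (xa 2))
        (c (xa 3) - c (xa 1)) := by
  have h0 : (0 : ZMod (2 * 2)).val = 0 := rfl
  have h1 : (1 : ZMod (2 * 2)).val = 1 := rfl
  have h2 : (2 : ZMod (2 * 2)).val = 2 := rfl
  have h3 : (3 : ZMod (2 * 2)).val = 3 := rfl
  rw [sum_two]
  simp only [toQuaternion, liftTwo_a, liftTwo_xa, h0, h1, h2, h3]
  apply Quaternion.ext <;> simp [pow_succ] <;> ring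

theorem sum_smul_signCharacter (u v : ℤˣ) (c : QuaternionGroup 2 → L) :
    ∑ q, c q • signCharacter L u v q = c (a 0) + c (a 2) + (c (a 1) + c (a 3)) * ((u : ℤ) : L) +
      (c (xa 0) + c (xa 2) + (c (xa 1) + c (xa 3)) * ((u : ℤ) : L)) * ((v : ℤ) : L) := by
  have h0 : (0 : ZMod (2 * 2)).val = 0 := rfl
  have h1 : (1 : ZMod (2 * 2)).val = 1 := rfl
  have h2 : (2 : ZMod (2 * 2)).val = 2 := rfl
  have h3 : (3 : ZMod (2 * 2)).val = 3 := rfl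
  rw [sum_two]
  simp only [signCharacter, MonoidHom.comp_apply, liftTwo_a, liftTwo_xa, h0, h1, h2, h3]
  rcases Int.units_eq_one_or u with rfl | rfl <;> rcases Int.units_eq_one_or v with rfl | rfl <;>
    simp <;> ring

/-- The four linear characters together with the quaternion representation separate the points
of the group algebra of `Q₈` when `2` is regular. -/
theorem eq_zero_of_sum_smul_eq_zero [NoZeroDivisors L] (h2 : (2 : L) ≠ 0)
    (c : QuaternionGroup 2 → L)
    (hsign : ∀ u v : ℤˣ, ∑ q, c q • signCharacter L u v q = 0)
    (hquat : ∑ q, c q • toQuaternion L q = 0) (q : QuaternionGroup 2) : c q = 0 := by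
  have hpp := hsign 1 1
  have hpm := hsign 1 (-1)
  have hmp := hsign (-1) 1
  have hmm := hsign (-1) (-1)
  rw [sum_smul_signCharacter] at hpp hpm hmp hmm
  rw [sum_smul_toQuaternion] at hquat
  have hre := congrArg (fun z : Quaternion L => z.re) hquat
  have hI := congrArg (fun z : Quaternion L => z.imI) hquat
  have hJ := congrArg (fun z : Quaternion L => z.imJ) hquat
  have hK := congrArg (fun z : Quaternion L => z.imK) hquat
  simp only [Units.val_one, Units.val_neg, Int.cast_one, Int.cast_neg] at hpp hpm hmp hmm
  simp only [Quaternion.re_ofCoords, Quaternion.imI_ofCoords, Quaternion.imJ_ofCoords,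
    Quaternion.imK_ofCoords, Quaternion.re_zero, Quaternion.imI_zero, Quaternion.imJ_zero,
    Quaternion.imK_zero] at hre hI hJ hK
  have key : ∀ z : L, 2 * (2 * (2 * z)) = 0 → z = 0 := fun z hz => by
    simpa [h2] using hz
  have hq : ∀ q : QuaternionGroup 2, q = a 0 ∨ q = a 1 ∨ q = a 2 ∨ q = a 3 ∨ q = xa 0 ∨
    q = xa 1 ∨ q = xa 2 ∨ q = xa 3 := by decide
  rcases hq q with rfl | rfl | rfl | rfl | rfl | rfl | rfl | rfl <;> apply key
  · linear_combination hpp + hpm + hmp + hmm + 4 * hre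
  · linear_combination hpp + hpm - hmp - hmm + 4 * hI
  · linear_combination hpp + hpm + hmp + hmm - 4 * hre
  · linear_combination hpp + hpm - hmp - hmm - 4 * hI
  · linear_combination hpp - hpm + hmp - hmm + 4 * hJ
  · linear_combination hpp - hpm - hmp + hmm - 4 * hK
  · linear_combination hpp - hpm + hmp - hmm - 4 * hJ
  · linear_combination hpp - hpm - hmp + hmm + 4 * hK

end QuaternionGroup

/-! ### Evaluating the group ring of `Q₈ × A` -/

section Evaluation

variable {R A L T : Type*} [CommRing R] [CommGroup A] [CommRing L] [Ring T] [Algebra L T]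

/-- The ring homomorphism from `R[Q₈ × A]` to an `L`-algebra given by `θ` on scalars, by `ρ` on
`Q₈` and by `χ` on `A`. -/
noncomputable def quaternionProdEval (θ : R →+* L) (χ : A →* L) (ρ : QuaternionGroup 2 →* T) :
    MonoidAlgebra R (QuaternionGroup 2 × A) →+* T :=
  liftNCRingHom ((algebraMap L T).comp θ)
    (ρ.noncommCoprod ((algebraMap L T : L →* T).comp χ)
      fun q a => (Algebra.commutes (χ a) (ρ q)).symm)
    fun r _ => Algebra.commutes (θ r) _

variable (θ : R →+* L) (χ : A →* L) (ρ : QuaternionGroup 2 →* T)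

theorem quaternionProdEval_single (q : QuaternionGroup 2) (a : A) (r : R) :
    quaternionProdEval θ χ ρ (single (q, a) r) = (θ r * χ a) • ρ q := by
  refine (liftNCRingHom_single _ _ _ _ _).trans ?_
  rw [Algebra.smul_def, map_mul, mul_assoc, Algebra.commutes (χ a)]
  rfl

theorem quaternionProdEval_apply [Fintype A]
    (x : MonoidAlgebra R (QuaternionGroup 2 × A)) :
    quaternionProdEval θ χ ρ x = ∑ q, (∑ a, θ (x.coeff (q, a)) * χ a) • ρ q := by
  induction x using MonoidAlgebra.induction_linear with
  | zero => simp
  | add x y hx hy =>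
    rw [map_add, hx, hy, ← Finset.sum_add_distrib]
    simp [add_mul, Finset.sum_add_distrib, add_smul]
  | single g r =>
    classical
    obtain ⟨q, a⟩ := g
    rw [quaternionProdEval_single, Finset.sum_eq_single q, Finset.sum_eq_single a]
    · simp
    · intro b _ hb
      simp [hb.symm]
    · simp
    · intro b _ hb
      simp [hb.symm]
    · simp

/-- The evaluation intertwines the canonical involution with every `L`-linear map `σ` that
restricts to inversion on the image of `Q₈`. -/
theorem quaternionProdEval_involution {σ : T → T} (hadd : ∀ x y, σ (x + y) = σ x + σ y)
    (hsmul : ∀ (l : L) x, σ (l • x) = l • σ x) (hρ : ∀ q, ρ q⁻¹ = σ (ρ q))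
    (x : MonoidAlgebra R (QuaternionGroup 2 × A)) :
    quaternionProdEval θ χ ρ
        (IsSLCGroup.groupRingInvolution R (QuaternionGroup 2 × A) x).unop =
      σ (quaternionProdEval θ χ ρ x) := by
  induction x using MonoidAlgebra.induction_linear with
  | zero => simpa using (hsmul 0 0).symm
  | add x y hx hy => rw [map_add, MulOpposite.unop_add, map_add, map_add, hadd, hx, hy]
  | single g r =>
    obtain ⟨q, a⟩ := g
    rw [IsSLCGroup.groupRingInvolution_single, IsSLCGroup.canonicalInvolution_quaternionProd,
      quaternionProdEval_single, quaternionProdEval_single, hsmul, hρ]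

theorem quaternionProdEval_toQuaternion_involution
    (x : MonoidAlgebra R (QuaternionGroup 2 × A)) :
    quaternionProdEval θ χ (QuaternionGroup.toQuaternion L)
        (IsSLCGroup.groupRingInvolution R (QuaternionGroup 2 × A) x).unop =
      star (quaternionProdEval θ χ (QuaternionGroup.toQuaternion L) x) :=
  quaternionProdEval_involution θ χ _ star_add (fun l x => by apply Quaternion.ext <;> simp)
    (QuaternionGroup.toQuaternion_inv L) x

theorem quaternionProdEval_signCharacter_involution (u v : ℤˣ)
    (x : MonoidAlgebra R (QuaternionGroup 2 × A)) :
    quaternionProdEval θ χ (QuaternionGroup.signCharacter L u v)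
        (IsSLCGroup.groupRingInvolution R (QuaternionGroup 2 × A) x).unop =
      quaternionProdEval θ χ (QuaternionGroup.signCharacter L u v) x :=
  quaternionProdEval_involution θ χ _ (σ := id) (fun _ _ => rfl) (fun _ _ => rfl)
    (QuaternionGroup.signCharacter_inv L u v) x

end Evaluation

section Field

variable {R A L : Type*} [CommRing R] [CommGroup A] [Field L]

/-- The norm form is anisotropic when `-1` is not a sum of three squares. -/
theorem Quaternion.eq_zero_of_self_mul_star_eq_zero
    (hL : ¬ ∃ X Y Z : L, X ^ 2 + Y ^ 2 + Z ^ 2 + 1 = 0) (q : Quaternion L)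
    (hq : q * star q = 0) : q = 0 := by
  have key : ∀ w x y z : L, w ^ 2 + x ^ 2 + y ^ 2 + z ^ 2 = 0 → w = 0 := fun w x y z h => by
    by_contra hw
    refine hL ⟨x / w, y / w, z / w, ?_⟩
    field_simp
    linear_combination h
  rw [Quaternion.self_mul_star, Quaternion.normSq_def'] at hq
  replace hq := congrArg (fun z : Quaternion L => z.re) hq
  simp only [Quaternion.re_coe, Quaternion.re_zero] at hq
  apply Quaternion.ext
  · exact key _ _ _ _ hq
  · exact key _ q.re q.imJ q.imK (by linear_combination hq)
  · exact key _ q.re q.imI q.imK (by linear_combination hq)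
  · exact key _ q.re q.imI q.imJ (by linear_combination hq)

/-- An element `x` with `x x* = 0` is killed by each of the representations of `Q₈`: the linear
characters are invariant under the involution, so they send `x x*` to a square. -/
theorem sum_coeff_eq_zero_of_mul_involution_eq_zero [Fintype A] (h2 : (2 : L) ≠ 0)
    (hL : ¬ ∃ X Y Z : L, X ^ 2 + Y ^ 2 + Z ^ 2 + 1 = 0) (θ : R →+* L) (χ : A →* L)
    {x : MonoidAlgebra R (QuaternionGroup 2 × A)}
    (hx : x * (IsSLCGroup.groupRingInvolution R (QuaternionGroup 2 × A) x).unop = 0)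
    (q : QuaternionGroup 2) : ∑ a, θ (x.coeff (q, a)) * χ a = 0 := by
  refine QuaternionGroup.eq_zero_of_sum_smul_eq_zero L h2
    (fun q => ∑ a, θ (x.coeff (q, a)) * χ a) (fun u v => ?_) ?_ q
  · have h := congrArg (quaternionProdEval θ χ (QuaternionGroup.signCharacter L u v)) hx
    rw [map_mul, quaternionProdEval_signCharacter_involution, map_zero, mul_self_eq_zero,
      quaternionProdEval_apply] at h
    exact h
  · have h := congrArg (quaternionProdEval θ χ (QuaternionGroup.toQuaternion L)) hx
    rw [map_mul, quaternionProdEval_toQuaternion_involution, map_zero] at h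
    rw [← quaternionProdEval_apply]
    exact Quaternion.eq_zero_of_self_mul_star_eq_zero hL _ h

/-- In a split quaternion algebra of characteristic not two, the only projections are `0` and
`1`, and neither of them can be subtracted from a nontrivial idempotent to leave a unit. -/
theorem not_isStarClean_of_sum_sq (h2 : (2 : L) ≠ 0) (θ : R →+* L) (χ : A →* L) {X Y Z W : L}
    (hXYZ : X ^ 2 + Y ^ 2 + Z ^ 2 + 1 = 0) (hW : 2 * W = 1)
    (hlift : ∀ z ∈ ({X, Y, Z, W} : Set L), algebraMap L (Quaternion L) z ∈
      (quaternionProdEval θ χ (QuaternionGroup.toQuaternion L)).range) :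
    ¬ IsStarClean (IsSLCGroup.groupRingInvolution R (QuaternionGroup 2 × A)) := by
  intro hclean
  let Ψ := quaternionProdEval θ χ (QuaternionGroup.toQuaternion L)
  have hQ : ∀ q, QuaternionGroup.toQuaternion L q ∈ Ψ.range := fun q =>
    ⟨single (q, 1) 1, by simp [Ψ, quaternionProdEval_single]⟩
  have hX := hlift X (by simp)
  have hY := hlift Y (by simp)
  have hZ := hlift Z (by simp)
  have hW' := hlift W (by simp)
  -- `e` is an idempotent with `star e = 1 - e` and of norm zero
  let e : Quaternion L := .ofCoords W (W * X) (W * Y) (W * Z)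
  have he : e ∈ Ψ.range := by
    have : e = algebraMap L _ W * (1 + algebraMap L _ X * QuaternionGroup.toQuaternion L (.a 1) +
        algebraMap L _ Y * QuaternionGroup.toQuaternion L (.xa 0) +
        algebraMap L _ Z * QuaternionGroup.toQuaternion L (.xa 3)) := by
      rw [QuaternionGroup.toQuaternion_a_one, QuaternionGroup.toQuaternion_xa_zero,
        QuaternionGroup.toQuaternion_xa_three, Quaternion.algebraMap_def]
      apply Quaternion.ext <;> simp [e]
    rw [this]
    exact mul_mem hW' (add_mem (add_mem (add_mem (one_mem _) (mul_mem hX (hQ _)))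
      (mul_mem hY (hQ _))) (mul_mem hZ (hQ _)))
  have hee : e * star e = 0 := by
    rw [Quaternion.self_mul_star, Quaternion.normSq_def']
    have : W ^ 2 + (W * X) ^ 2 + (W * Y) ^ 2 + (W * Z) ^ 2 = 0 := by
      linear_combination W ^ 2 * hXYZ
    simp [e, this]
  have hstar : star e = 1 - e := by
    apply Quaternion.ext <;> simp [e]
    linear_combination hW
  have hW0 : W ≠ 0 := fun h => by simp [h] at hW
  have hu : ¬ IsUnit e := fun h => by
    have := congrArg (fun z : Quaternion L => z.re) (h.mul_right_eq_zero.1 hee)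
    simp [e, hW0] at this
  have hu' : ¬ IsUnit (e - 1) := fun h => by
    have h' : IsUnit (star e) := by rw [hstar, ← neg_sub]; exact h.neg
    have := congrArg (fun z : Quaternion L => z.re) (h'.mul_left_eq_zero.1 hee)
    simp [e, hW0] at this
  obtain ⟨x, hx⟩ := he
  obtain ⟨u, p, hunit, hp, hpσ, rfl⟩ := hclean x
  have hpstar : star (Ψ p) = Ψ p := by
    rw [← quaternionProdEval_toQuaternion_involution, hpσ]
  have hpp : Ψ p * Ψ p = Ψ p := by rw [← map_mul, hp.eq]
  have hus : Ψ u = e - Ψ p := by rw [← hx, map_add, add_sub_cancel_right]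
  have hΨu : IsUnit (Ψ u) := hunit.map Ψ
  have him : ∀ z : L, -z = z → z = 0 := fun z hz => by
    have : 2 * z = 0 := by linear_combination -hz
    simpa [h2] using this
  -- a quaternion fixed by conjugation is a scalar
  obtain ⟨l, hl⟩ : ∃ l : L, Ψ p = (l : Quaternion L) := by
    refine ⟨(Ψ p).re, ?_⟩
    apply Quaternion.ext
    · simp
    · simpa using him _ (by simpa using congrArg (fun z : Quaternion L => z.imI) hpstar)
    · simpa using him _ (by simpa using congrArg (fun z : Quaternion L => z.imJ) hpstar)
    · simpa using him _ (by simpa using congrArg (fun z : Quaternion L => z.imK) hpstar)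
  have hll : l * l = l := by
    rw [hl, ← Quaternion.coe_mul] at hpp
    exact Quaternion.coe_injective hpp
  rcases IsIdempotentElem.iff_eq_zero_or_one.1 hll with rfl | rfl
  · exact hu (by rwa [hus, hl, Quaternion.coe_zero, sub_zero] at hΨu)
  · exact hu' (by rwa [hus, hl, Quaternion.coe_one] at hΨu)

end Field

/-! ### Characters of finite abelian groups and cyclotomic fields -/

section Characters

variable {F A : Type*} [Field F]

theorem two_ne_zero_of_algebra (F : Type*) {L : Type*} [Field F] [Field L] [Algebra F L]
    (h : (2 : F) ≠ 0) : (2 : L) ≠ 0 := by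
  rw [← map_ofNat (algebraMap F L) 2]
  exact (map_ne_zero _).2 h

theorem neZero_natCast_of_dvd_card [h : NeZero (Nat.card A : F)] {d : ℕ} (hd : d ∣ Nat.card A) :
    NeZero (d : F) := by
  refine ⟨fun h0 => h.out ?_⟩
  obtain ⟨k, hk⟩ := hd
  rw [hk, Nat.cast_mul, h0, zero_mul]

variable [CommGroup A] [Finite A]

/-- The image of a character with values in a field is cyclic. -/
theorem exists_forall_exists_pow_eq {M : Type*} [Field M] (χ : A →* Mˣ) :
    ∃ a, ∀ b, ∃ k : ℕ, χ a ^ k = χ b := by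
  have : Finite χ.range := inferInstanceAs (Finite (Set.range χ))
  obtain ⟨⟨_, a, rfl⟩, hg⟩ := IsCyclic.exists_monoid_generator (α := χ.range)
  refine ⟨a, fun b => ?_⟩
  obtain ⟨k, hk⟩ := hg ⟨χ b, b, rfl⟩
  exact ⟨k, congrArg Subtype.val hk⟩

/-- A quotient field of the group algebra of a finite abelian group `A` is the cyclotomic extension
generated by the image of `A`, a finite cyclic group whose order is the order of an element of
`A`. -/
theorem exists_orderOf_eq_and_isCyclotomicExtension {L : Type*} [Field L] [Algebra F L]
    (φ : MonoidAlgebra F A →ₐ[F] L) (hφ : Function.Surjective φ) :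
    ∃ d, (∃ g : A, orderOf g = d) ∧ IsCyclotomicExtension {d} F L := by
  let χ : A →* Lˣ := MonoidHom.toHomUnits ((φ : MonoidAlgebra F A →* L).comp (of F A))
  have hχ : ∀ a, (χ a : L) = φ (of F A a) := fun a => rfl
  obtain ⟨a, ha⟩ := exists_forall_exists_pow_eq χ
  have hd : orderOf (χ a) ∣ orderOf a := orderOf_map_dvd χ a
  have : NeZero (orderOf (χ a)) := ⟨(Nat.pos_of_dvd_of_pos hd (orderOf_pos a)).ne'⟩
  refine ⟨orderOf (χ a), ⟨_, orderOf_pow_orderOf_div (orderOf_pos a).ne' hd⟩, ?_⟩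
  refine (IsCyclotomicExtension.iff_singleton _ F L).2
    ⟨⟨χ a, IsPrimitiveRoot.coe_units_iff.2 (IsPrimitiveRoot.orderOf _)⟩, fun z => ?_⟩
  obtain ⟨y, rfl⟩ := hφ z
  induction y using MonoidAlgebra.induction_linear with
  | zero => rw [map_zero]; exact zero_mem _
  | add x y hx hy => rw [map_add]; exact add_mem hx hy
  | single b r =>
    rw [← mul_one r, ← smul_eq_mul, ← smul_single, map_smul]
    refine Subalgebra.smul_mem _ (Algebra.subset_adjoin ?_) r
    obtain ⟨k, hk⟩ := ha b
    change (χ b : L) ^ _ = 1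
    rw [← hk, ← Units.val_pow_eq_pow_val, pow_right_comm, pow_orderOf_eq_one, one_pow,
      Units.val_one]

/-- By Maschke's theorem the group algebra has trivial Jacobson radical. -/
theorem MonoidAlgebra.eq_zero_of_forall_mem_isMaximal [NeZero (Nat.card A : F)]
    (y : MonoidAlgebra F A) (hy : ∀ m : Ideal (MonoidAlgebra F A), m.IsMaximal → y ∈ m) :
    y = 0 := by
  have h : y ∈ Ring.jacobson (MonoidAlgebra F A) := by
    rw [Ring.jacobson_eq_sInf_isMaximal]
    exact Ideal.mem_sInf.2 fun {m} hm => hy m hm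
  rwa [IsSemisimpleRing.jacobson_eq_bot] at h

/-- As `A` is isomorphic to its character group, it has a character whose order is the order `d` of
a given element; the values of this character generate the `d`-th cyclotomic extension. -/
theorem exists_character_cyclotomicField_le_adjoin [NeZero (Nat.card A : F)] {d : ℕ}
    (hd : ∃ g : A, orderOf g = d) {M : Type*} [Field M] [IsSepClosed M] [Algebra F M]
    (j : CyclotomicField d F →ₐ[F] M) :
    ∃ χ : A →* M, ∀ z, j z ∈ Algebra.adjoin F (Set.range χ) := by
  obtain ⟨g, hg⟩ := hd
  have : NeZero (Monoid.exponent A : F) := neZero_natCast_of_dvd_card Group.exponent_dvd_nat_card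
  have : NeZero (Monoid.exponent A : M) := NeZero.nat_of_injective (algebraMap F M).injective
  have hdF : NeZero (d : F) := neZero_natCast_of_dvd_card (A := A) (hg ▸ orderOf_dvd_natCard g)
  have : NeZero d := .of_neZero_natCast F
  obtain ⟨E⟩ := CommGroup.monoidHom_mulEquiv_of_hasEnoughRootsOfUnity A M
  have hE : orderOf (E.symm g) = d := by rw [MulEquiv.orderOf_eq, hg]
  obtain ⟨a, ha⟩ := exists_forall_exists_pow_eq (E.symm g)
  have hord : orderOf (E.symm g a) = d := by
    rw [← hE]
    refine Nat.dvd_antisymm (orderOf_dvd_of_pow_eq_one ?_) (orderOf_dvd_of_pow_eq_one ?_)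
    · rw [← MonoidHom.pow_apply, pow_orderOf_eq_one, MonoidHom.one_apply]
    · ext b
      obtain ⟨k, hk⟩ := ha b
      rw [MonoidHom.pow_apply, ← hk, pow_right_comm, pow_orderOf_eq_one, one_pow,
        MonoidHom.one_apply]
  have hprim : IsPrimitiveRoot (E.symm g a : M) d :=
    IsPrimitiveRoot.coe_units_iff.2 (hord ▸ IsPrimitiveRoot.orderOf _)
  refine ⟨(Units.coeHom M).comp (E.symm g), fun z => ?_⟩
  have hle : Algebra.adjoin F {b : CyclotomicField d F | b ^ d = 1} ≤
      (Algebra.adjoin F (Set.range ((Units.coeHom M).comp (E.symm g)))).comap j := by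
    refine Algebra.adjoin_le fun b hb => ?_
    obtain ⟨k, _, hk⟩ := hprim.eq_pow_of_pow_eq_one (ξ := j b) (by rw [← map_pow, hb, map_one])
    refine (Subalgebra.mem_comap _ _ _).2 ?_
    rw [← hk]
    exact pow_mem (Algebra.subset_adjoin (Set.mem_range_self a)) k
  exact hle (((IsCyclotomicExtension.iff_singleton d F (CyclotomicField d F)).1 inferInstance).2 z)

end Characters

/-! ### The criterion for `*`-cleanness -/

theorem theoremC {ι : Type*} [Finite ι] (F : ι → Type*) [∀ i, Field (F i)]
    (A : Type*) [CommGroup A] [Finite A]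
    (hchar : ∀ i, ¬ ringChar (F i) ∣ Nat.card (QuaternionGroup 2 × A)) :
    IsStarClean (IsSLCGroup.groupRingInvolution (∀ i, F i) (QuaternionGroup 2 × A)) ↔
      ∀ i : ι, ∀ d : ℕ, (∃ g : A, orderOf g = d) →
        ¬ ∃ X Y Z : CyclotomicField d (F i), X ^ 2 + Y ^ 2 + Z ^ 2 + 1 = 0 := by
  have : Fintype A := Fintype.ofFinite A
  have hcard : Nat.card (QuaternionGroup 2 × A) = 2 * 4 * Nat.card A := by
    rw [Nat.card_prod, Nat.card_eq_fintype_card, QuaternionGroup.card]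
  have h2 : ∀ i, (2 : F i) ≠ 0 := fun i h => hchar i (by
    rw [← ringChar.spec, hcard]
    rw [Nat.cast_mul, Nat.cast_mul, Nat.cast_ofNat, h, zero_mul, zero_mul])
  have hA : ∀ i, NeZero (Nat.card A : F i) := fun i => ⟨fun h => hchar i (by
    rw [← ringChar.spec, hcard]
    rw [Nat.cast_mul, h, mul_zero])⟩
  constructor
  · rintro hclean i d hd ⟨X, Y, Z, hXYZ⟩
    let M := AlgebraicClosure (CyclotomicField d (F i))
    let j : CyclotomicField d (F i) →ₐ[F i] M := IsScalarTower.toAlgHom _ _ _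
    obtain ⟨χ, hχ⟩ := exists_character_cyclotomicField_le_adjoin hd j
    let θ : (∀ i, F i) →+* M := (algebraMap (F i) M).comp (Pi.evalRingHom F i)
    let Ψ := quaternionProdEval θ χ (QuaternionGroup.toQuaternion M)
    have hmem : ∀ z : CyclotomicField d (F i), algebraMap M ℍ[M] (j z) ∈ Ψ.range := by
      intro z
      have hz := hχ z
      generalize j z = w at hz
      classical
      induction hz using Algebra.adjoin_induction with
      | mem x hx =>
        obtain ⟨a, rfl⟩ := hx
        exact ⟨single (1, a) 1, by
          simp [Ψ, quaternionProdEval_single, Algebra.algebraMap_eq_smul_one]⟩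
      | algebraMap r =>
        exact ⟨single (1, 1) (Pi.single i r), by
          simp [Ψ, quaternionProdEval_single, Algebra.algebraMap_eq_smul_one, θ]⟩
      | add x y _ _ hx hy => rw [map_add]; exact add_mem hx hy
      | mul x y _ _ hx hy => rw [map_mul]; exact mul_mem hx hy
    have hM : (2 : M) ≠ 0 := two_ne_zero_of_algebra (F i) (h2 i)
    refine not_isStarClean_of_sum_sq hM θ χ (X := j X) (Y := j Y) (Z := j Z) (W := j 2⁻¹) ?_ ?_ ?_
      hclean
    · rw [← map_pow, ← map_pow, ← map_pow, ← map_add, ← map_add, ← map_one j, ← map_add, hXYZ,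
        map_zero]
    · rw [← map_ofNat j 2, ← map_mul, mul_inv_cancel₀ (two_ne_zero_of_algebra (F i) (h2 i)),
        map_one]
    · rintro z (rfl | rfl | rfl | rfl) <;> exact hmem _
  · intro h
    refine isStarClean_of_proper (R := ∀ i, F i) _ IsSLCGroup.groupRingInvolution_algebraMap
      IsSLCGroup.commute_groupRingInvolution fun x hx => ?_
    ext ⟨q, a⟩ i
    -- the component of `x` in `F i [A]` at the group element `q`
    let y : MonoidAlgebra (F i) A := ∑ b, single b (x.coeff (q, b) i)
    have hy : y = 0 := by
      refine eq_zero_of_forall_mem_isMaximal y fun m hm => ?_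
      let := Ideal.Quotient.field m
      let φ : MonoidAlgebra (F i) A →ₐ[F i] MonoidAlgebra (F i) A ⧸ m := Ideal.Quotient.mkₐ _ m
      obtain ⟨d, hd, hcyc⟩ := exists_orderOf_eq_and_isCyclotomicExtension φ
        (Ideal.Quotient.mkₐ_surjective _ _)
      have : NeZero (d : F i) := neZero_natCast_of_dvd_card (A := A) (by
        obtain ⟨g, rfl⟩ := hd
        exact orderOf_dvd_natCard g)
      have : NeZero d := .of_neZero_natCast (F i)
      let e := IsCyclotomicExtension.algEquiv {d} (F i) (MonoidAlgebra (F i) A ⧸ m)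
        (CyclotomicField d (F i))
      have hL : ¬ ∃ X Y Z : MonoidAlgebra (F i) A ⧸ m, X ^ 2 + Y ^ 2 + Z ^ 2 + 1 = 0 := by
        rintro ⟨X, Y, Z, hXYZ⟩
        exact h i d hd ⟨e X, e Y, e Z, by simpa using congrArg e hXYZ⟩
      have key := sum_coeff_eq_zero_of_mul_involution_eq_zero (two_ne_zero_of_algebra (F i) (h2 i))
        hL
        ((algebraMap (F i) _).comp (Pi.evalRingHom F i))
        ((φ : MonoidAlgebra (F i) A →* MonoidAlgebra (F i) A ⧸ m).comp (of (F i) A)) hx q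
      rw [← Ideal.Quotient.eq_zero_iff_mem]
      change φ y = 0
      rw [← key, map_sum]
      refine Finset.sum_congr rfl fun b _ => ?_
      change φ (single b _) = algebraMap (F i) _ _ * φ (single b 1)
      rw [← Algebra.smul_def, ← map_smul, smul_single, smul_eq_mul, mul_one]
      rfl
    have := congrArg (fun z => z.coeff a) hy
    classical
    simpa [y, Finsupp.single_apply] using this
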